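/- Let $M\ge 3$, let $\mathcal K\subseteq\{1,\dots,M\}$ (the active users), and put $I_k=1$ if $k\in\mathcal K$ and $I_k=0$ otherwise. For each user $k$ let $\gamma_k$ be a target SINR, $\mathbf v_k\in\mathbb R^M$ a fixed beamforming vector (for instance a unit-norm zero-forcing vector), and $$S_k=\{\mathbf w\in\mathbb R^M:\ \sqrt{r_k}\le\|\mathbf w\|<\sqrt{R_k},\ \angle(\mathbf w,\tilde{\mathbf u}_k)<\phi_k\}$$ a sector-type uncertainty region, where $\angle(\mathbf w,\tilde{\mathbf u})\in[0,\pi/2]$ is the angle between the lines spanned by $\mathbf w$ and $\tilde{\mathbf u}$. Suppose that $\gamma_k>0$, $0<r_k<R_k\le\infty$, $\|\tilde{\mathbf u}_k\|=1$ and $0<\phi_k<\pi/2$ for $k\in\mathcal K$. Then the robust power control problem $$\min_{P_1,\dots,P_M\ge 0}\ \sum_{k=1}^M P_k\quad\text{s.t.}\quad \inf_{\mathbf w\in S_k}\frac{P_k|\mathbf w^T\mathbf v_k|^2}{\sum_{l\ne k}P_l|\mathbf w^T\mathbf v_l|^2+1}\ \ge\ \gamma_kI_k,\quad k=1,\dots,M,$$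 is equivalent to the semidefinite program $$\min_{(P_k,\lambda_k,\mu_k)_{k\in\mathcal K}}\ \sum_{k\in\mathcal K}P_k\quad\text{s.t.}\quad \frac1{\gamma_k}P_k\mathbf v_k\mathbf v_k^T-\sum_{l\in\mathcal K,\,l\ne k}P_l\mathbf v_l\mathbf v_l^T\succeq(\lambda_k-\mu_k)\mathbf I_M+\frac{\mu_k}{\cos^2\phi_k}\tilde{\mathbf u}_k\tilde{\mathbf u}_k^T,\quad \lambda_k\ge\frac1{r_k},\ \mu_k\ge0,\ P_k\ge0,\quad k\in\mathcal K,$$ in the following sense. (i) For real numbers $(P_k)_{k\in\mathcal K}$, extended by $P_k=0$ for $k\notin\mathcal K$, the two objectives agree, and $(P_k)_{k\le M}$ is feasible for the robust problem if and only if there are $(\lambda_k,\mu_k)_{k\in\mathcal K}$ such that $(P_k,\lambda_k,\mu_k)_{k\in\mathcal K}$ is feasible for the SDP. (ii) If $(P_k)_{k\le M}$ is feasible for the robust problem, then $(P_k,\lambda_k,\mu_k)_{k\in\mathcal K}$ is feasible for the SDP for some $(\lambda_k,\mu_k)_{k\in\mathcal K}$. (iii) The optimal values (infima, $+\infty$ if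 infeasible) coincide. (iv) $(P_k)_{k\le M}$ is optimal for the robust problem if and only if $P_k=0$ for all $k\notin\mathcal K$ and $(P_k,\lambda_k,\mu_k)_{k\in\mathcal K}$ is optimal for the SDP for some $(\lambda_k,\mu_k)_{k\in\mathcal K}$. -/

import Mathlib

open scoped ENNReal

noncomputable section

/-- The angle between the lines spanned by `x` and `y`, a number in `[0, π/2]`. -/
def lineAngle {M : ℕ} (x y : EuclideanSpace ℝ (Fin M)) : ℝ :=
  min (InnerProductGeometry.angle x y) (Real.pi - InnerProductGeometry.angle x y)

/-- The sector-type region `{h | √r ≤ ‖h‖ < √R, ∠(h, u) < φ}`. The outer radius may be infinite,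
so `R` is an extended nonnegative real, and `‖h‖ < √R` is written as `‖h‖² < R`. -/
def sectorRegion {M : ℕ} (R : ℝ≥0∞) (r : ℝ) (u : EuclideanSpace ℝ (Fin M)) (φ : ℝ) :
    Set (EuclideanSpace ℝ (Fin M)) :=
  {h | √r ≤ ‖h‖ ∧ ‖h‖ₑ ^ 2 < R ∧ lineAngle h u < φ}

/-- The data of the power control problem with `M` antennas and `M` users. -/
structure PowerControlData (M : ℕ) where
  /-- The set of active users; the other users are silent. -/
  K : Finset (Fin M)
  /-- The target SINR values. -/
  γ : Fin M → ℝ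
  /-- The squared outer radii of the uncertainty regions. -/
  R : Fin M → ℝ≥0∞
  /-- The squared inner radii of the uncertainty regions (quantized magnitudes). -/
  r : Fin M → ℝ
  /-- The quantized directions. -/
  u : Fin M → EuclideanSpace ℝ (Fin M)
  /-- The angular openings of the uncertainty regions. -/
  φ : Fin M → ℝ
  /-- The fixed beamforming vectors. -/
  v : Fin M → EuclideanSpace ℝ (Fin M)

namespace PowerControlData

variable {M : ℕ} (D : PowerControlData M)

/-- The uncertainty region of user `k`. -/
def region (k : Fin M) : Set (EuclideanSpace ℝ (Fin M)) :=
  sectorRegion (D.R k) (D.r k) (D.u k) (D.φ k)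

/-- The activity flag of user `k`. -/
def flag (k : Fin M) : ℝ := if k ∈ D.K then 1 else 0

/-- The SINR of user `k` for the channel vector `w` and the power levels `P`, with unit noise
power. -/
def sinr (P : Fin M → ℝ) (k : Fin M) (w : EuclideanSpace ℝ (Fin M)) : ℝ :=
  (P k * |inner ℝ w (D.v k)| ^ 2) /
    ((∑ l ∈ Finset.univ.erase k, P l * |inner ℝ w (D.v l)| ^ 2) + 1)

/-- Feasibility in the robust (worst-case SINR) power control problem. -/
def RobustFeasible (P : Fin M → ℝ) : Prop :=
  (∀ k, 0 ≤ P k) ∧ ∀ k, (⨅ w : D.region k, D.sinr P k w) ≥ D.γ k * D.flag k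

/-- The objective of the robust problem. -/
def robustObjective (P : Fin M → ℝ) : ℝ := ∑ k, P k

/-- `P` is an optimal solution of the robust problem. -/
def RobustOptimal (P : Fin M → ℝ) : Prop :=
  D.RobustFeasible P ∧ ∀ P', D.RobustFeasible P' → robustObjective P ≤ robustObjective P'

/-- The optimal value of the robust problem (`⊤` if it is infeasible). -/
def robustValue : EReal :=
  ⨅ (P : Fin M → ℝ) (_ : D.RobustFeasible P), (robustObjective P : EReal)

/-- The difference of the two sides of the linear matrix inequality of user `k`. -/
def lmi (p lam mu : D.K → ℝ) (k : D.K) : Matrix (Fin M) (Fin M) ℝ :=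
  ((1 / D.γ k * p k) • Matrix.vecMulVec (D.v k) (D.v k)
      - ∑ l ∈ Finset.univ.erase k, p l • Matrix.vecMulVec (D.v l) (D.v l))
    - ((lam k - mu k) • (1 : Matrix (Fin M) (Fin M) ℝ)
      + (mu k / Real.cos (D.φ k) ^ 2) • Matrix.vecMulVec (D.u k) (D.u k))

/-- Feasibility in the SDP, whose variables are indexed by the active users. -/
def SDPFeasible (p lam mu : D.K → ℝ) : Prop :=
  ∀ k, (D.lmi p lam mu k).PosSemidef ∧ lam k ≥ 1 / D.r k ∧ mu k ≥ 0 ∧ p k ≥ 0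

/-- The objective of the SDP. -/
def sdpObjective (p : D.K → ℝ) : ℝ := ∑ k, p k

/-- `(p, lam, mu)` is an optimal solution of the SDP. -/
def SDPOptimal (p lam mu : D.K → ℝ) : Prop :=
  D.SDPFeasible p lam mu ∧
    ∀ p' lam' mu', D.SDPFeasible p' lam' mu' → D.sdpObjective p ≤ D.sdpObjective p'

/-- The optimal value of the SDP (`⊤` if it is infeasible). -/
def sdpValue : EReal :=
  ⨅ (p : D.K → ℝ) (lam : D.K → ℝ) (mu : D.K → ℝ) (_ : D.SDPFeasible p lam mu),
    (D.sdpObjective p : EReal)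

/-- The powers of the active users, extended by zero to the silent users. -/
def extend (p : D.K → ℝ) (k : Fin M) : ℝ := if h : k ∈ D.K then p ⟨k, h⟩ else 0

end PowerControlData

end

/-! With nonnegative powers, clearing the denominator turns `γ ≤ SINR` for an active user into `1 ≤
wᵀAw`, where `A` is its `margin` matrix. The angle condition says that `w` lies in the open double
cone `q > 0`, where `q w = (w·u)² / cos² φ - ‖w‖²`. Every ray of that cone meets the region at
radius `√r`, so by homogeneity the constraint on the region amounts to `p w = wᵀAw - ‖w‖² / r ≥ 0`
on the cone. The S-lemma, proved here for an open cone, turns this into `p ≥ μ q` everywhere for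
some `μ ≥ 0`, which is the matrix inequality with `λ = 1 / r`. Conversely, on the region `λ‖w‖² ≥ 1`
and `μ q w ≥ 0`, so any multipliers suffice. Silent users only cause interference and cost power:
setting their powers to zero keeps feasibility, and an optimum has none. -/

/-! ### The S-lemma for two quadratic forms -/

open Filter Topology in
/-- Values of a quadratic form that is nonnegative on the open cone `{q > 0}` are nonnegative on
the closed cone `{q ≥ 0}`, provided that the open cone is nonempty. -/
theorem QuadraticMap.nonneg_of_nonneg_on_pos {V : Type*} [AddCommGroup V] [Module ℝ V]
    {p q : QuadraticForm ℝ V} {x₀ : V} (hx₀ : 0 < q x₀) (h : ∀ x, 0 < q x → 0 ≤ p x)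
    {y : V} (hy : 0 ≤ q y) : 0 ≤ p y := by
  -- Choosing the sign of `x₀` makes the cross term nonnegative, so `y + t • x` lies in the open
  -- cone for every `t > 0`; then let `t → 0`.
  obtain ⟨x, hx, hpol⟩ : ∃ x, 0 < q x ∧ 0 ≤ QuadraticMap.polar q y x := by
    rcases le_total 0 (QuadraticMap.polar q y x₀) with hp | hp
    · exact ⟨x₀, hx₀, hp⟩
    · exact ⟨-x₀, by simpa using hx₀, by simpa using hp⟩
  have expand (f : QuadraticForm ℝ V) (t : ℝ) :
      f (y + t • x) = f y + t * QuadraticMap.polar f y x + t ^ 2 * f x := by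
    rw [QuadraticMap.map_add f, QuadraticMap.map_smul, QuadraticMap.polar_smul_right]
    simp only [smul_eq_mul]; ring
  have hlim : Tendsto (fun t : ℝ => p y + t * QuadraticMap.polar p y x + t ^ 2 * p x)
      (𝓝[>] 0) (𝓝 (p y)) := by
    have hc : Continuous fun t : ℝ => p y + t * QuadraticMap.polar p y x + t ^ 2 * p x := by
      fun_prop
    simpa using (hc.tendsto 0).mono_left nhdsWithin_le_nhds
  refine ge_of_tendsto hlim ?_
  filter_upwards [self_mem_nhdsWithin] with t ht
  have ht : 0 < t := ht
  rw [← expand]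
  refine h _ ?_
  rw [expand]
  positivity

/-- A quadratic polynomial with negative leading and positive constant coefficient has two real
roots of opposite sign, whose product is the quotient of these coefficients. -/
theorem exists_roots_of_neg_of_pos {a b c : ℝ} (ha : a < 0) (hc : 0 < c) :
    ∃ s t : ℝ, s < t ∧ c + s * b + s ^ 2 * a = 0 ∧ c + t * b + t ^ 2 * a = 0 ∧
      s < 0 ∧ 0 < t ∧ s * t * a = c := by
  have ha' : a ≠ 0 := ha.ne
  have hdisc : b ^ 2 < b ^ 2 - 4 * a * c := by nlinarith [mul_pos (neg_pos.mpr ha) hc]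
  set d := √(b ^ 2 - 4 * a * c) with hd
  have hdsq : d ^ 2 = b ^ 2 - 4 * a * c := Real.sq_sqrt (by nlinarith [sq_nonneg b])
  have hbd : |b| < d := Real.lt_sqrt_of_sq_lt (by simpa using hdisc)
  obtain ⟨h1, h2⟩ := abs_lt.mp hbd
  have hroot (x : ℝ) (hx : x ^ 2 = d ^ 2) :
      c + (-b + x) / (2 * a) * b + ((-b + x) / (2 * a)) ^ 2 * a = 0 := by
    rw [hdsq] at hx
    field_simp
    linear_combination hx
  have hs : (-b + d) / (2 * a) < 0 := div_neg_of_pos_of_neg (by linarith) (by linarith)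
  have ht : 0 < (-b + -d) / (2 * a) := div_pos_of_neg_of_neg (by linarith) (by linarith)
  refine ⟨_, _, hs.trans ht, hroot d rfl, hroot (-d) (by ring), hs, ht, ?_⟩
  field_simp
  linear_combination -hdsq

/-- The key inequality behind the S-lemma. -/
theorem QuadraticMap.mul_le_mul_of_nonneg_on_nonneg {V : Type*} [AddCommGroup V] [Module ℝ V]
    {p q : QuadraticForm ℝ V} (h : ∀ x, 0 ≤ q x → 0 ≤ p x) {x y : V} (hx : 0 < q x)
    (hy : q y < 0) : p x * q y ≤ q x * p y := by
  have expand (f : QuadraticForm ℝ V) (t : ℝ) :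
      f (x + t • y) = f x + t * QuadraticMap.polar f x y + t ^ 2 * f y := by
    rw [QuadraticMap.map_add f, QuadraticMap.map_smul, QuadraticMap.polar_smul_right]
    simp only [smul_eq_mul]; ring
  obtain ⟨s, t, hst, hqs, hqt, hs, ht, hprod⟩ :=
    exists_roots_of_neg_of_pos (b := QuadraticMap.polar q x y) hy hx
  have hps := h (x + s • y) (by rw [expand, hqs])
  have hpt := h (x + t • y) (by rw [expand, hqt])
  rw [expand] at hps hpt
  -- Both `x + s • y` and `x + t • y` are zeros of `q`. Weighting the values of `p` there by `t` and
  -- `-s` cancels the polar term.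
  have hcomb : 0 ≤ (t - s) * (p x - s * t * p y) := by
    nlinarith [mul_nonneg ht.le hps, mul_nonneg (neg_nonneg.mpr hs.le) hpt]
  have hle : 0 ≤ p x - s * t * p y := nonneg_of_mul_nonneg_right hcomb (by linarith)
  rw [← hprod]
  nlinarith [mul_nonneg hle (neg_nonneg.mpr hy.le)]

/-- The homogeneous S-lemma of Yakubovich. -/
theorem QuadraticMap.exists_multiplier_of_nonneg_on_pos {V : Type*} [AddCommGroup V] [Module ℝ V]
    {p q : QuadraticForm ℝ V} {x₀ : V} (hx₀ : 0 < q x₀) (h : ∀ x, 0 < q x → 0 ≤ p x) :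
    ∃ μ : ℝ, 0 ≤ μ ∧ ∀ x, μ * q x ≤ p x := by
  have hclosed : ∀ x, 0 ≤ q x → 0 ≤ p x := fun x hx => nonneg_of_nonneg_on_pos hx₀ h hx
  -- The multiplier must dominate `p y / q y` wherever `q y < 0`. Inserting `0` forces it to be
  -- nonnegative and covers the case where `q` is never negative.
  set S : Set ℝ := insert 0 ((fun y => p y / q y) '' {y | q y < 0})
  have hbound (x : V) (hx : 0 < q x) : p x / q x ∈ upperBounds S := by
    rintro _ (rfl | ⟨y, hy, rfl⟩)
    · exact div_nonneg (h x hx) hx.le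
    · have hy : q y < 0 := hy
      have := mul_le_mul_of_nonneg_on_nonneg hclosed hx hy
      rw [div_le_iff_of_neg hy, div_mul_eq_mul_div, div_le_iff₀ hx]
      linarith
  have hbdd : BddAbove S := ⟨_, hbound x₀ hx₀⟩
  have hne : S.Nonempty := ⟨0, Set.mem_insert _ _⟩
  refine ⟨sSup S, le_csSup hbdd (Set.mem_insert _ _), fun x => ?_⟩
  rcases lt_trichotomy (q x) 0 with hx | hx | hx
  · rw [← div_le_iff_of_neg hx]
    exact le_csSup hbdd (Set.mem_insert_of_mem _ ⟨x, hx, rfl⟩)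
  · simpa [hx] using hclosed x hx.ge
  · rw [← le_div_iff₀ hx]
    exact csSup_le hne (hbound x hx)

/-! ### Sector regions as truncated quadratic cones -/

/-- The angle between lines is the arccosine of `|⟪h, u⟫| / ‖h‖`; both sides of the cosine
inequality are nonnegative, so it can be squared. -/
theorem lineAngle_lt_iff {M : ℕ} {h u : EuclideanSpace ℝ (Fin M)} (hh : h ≠ 0) (hu : ‖u‖ = 1)
    {φ : ℝ} (hφ : 0 < φ) (hφ' : φ < Real.pi / 2) :
    lineAngle h u < φ ↔ Real.cos φ ^ 2 * ‖h‖ ^ 2 < inner ℝ h u ^ 2 := by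
  have hn : 0 < ‖h‖ := norm_pos_iff.mpr hh
  have hcos : 0 < Real.cos φ := Real.cos_pos_of_mem_Ioo ⟨by linarith, hφ'⟩
  have hle : |inner ℝ h u| ≤ ‖h‖ := by simpa [hu] using abs_real_inner_le_norm h u
  have hang : lineAngle h u = Real.arccos (|inner ℝ h u| / ‖h‖) := by
    rw [lineAngle, InnerProductGeometry.angle, ← Real.arccos_neg, hu, mul_one,
      ← Real.antitone_arccos.map_max, ← abs_eq_max_neg, abs_div, abs_of_pos hn]
  have hiff : lineAngle h u < φ ↔ Real.cos φ < |inner ℝ h u| / ‖h‖ := by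
    have h1 : |inner ℝ h u| / ‖h‖ ≤ 1 := (div_le_one hn).mpr hle
    have h0 : 0 ≤ |inner ℝ h u| / ‖h‖ := by positivity
    rw [hang, ← Real.strictAntiOn_cos.lt_iff_gt ⟨hφ.le, by linarith⟩
      ⟨Real.arccos_nonneg _, Real.arccos_le_pi _⟩, Real.cos_arccos (by linarith) h1]
  rw [hiff, lt_div_iff₀ hn, ← mul_pow, sq_lt_sq, abs_of_pos (mul_pos hcos hn)]

theorem EuclideanSpace.dotProduct_vecMulVec_mulVec {M : ℕ} (v w : EuclideanSpace ℝ (Fin M)) :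
    w.ofLp ⬝ᵥ (Matrix.vecMulVec v v).mulVec w = inner ℝ w v ^ 2 := by
  have h : inner ℝ w v = w.ofLp ⬝ᵥ v.ofLp := by
    rw [dotProduct_comm]; rfl
  rw [Matrix.vecMulVec_mulVec, h]
  simp [dotProduct_comm v.ofLp, sq]

theorem EuclideanSpace.dotProduct_self {M : ℕ} (w : EuclideanSpace ℝ (Fin M)) :
    w.ofLp ⬝ᵥ w.ofLp = ‖w‖ ^ 2 := by
  rw [← real_inner_self_eq_norm_sq]; rfl

theorem le_norm_sq_and_lt_inner_sq_of_mem_sectorRegion {M : ℕ} {R : ℝ≥0∞} {r φ : ℝ} {u : EuclideanSpace ℝ (Fin M)}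
    (hr : 0 < r) (hu : ‖u‖ = 1) (hφ : 0 < φ) (hφ' : φ < Real.pi / 2)
    {w : EuclideanSpace ℝ (Fin M)} (hw : w ∈ sectorRegion R r u φ) :
    r ≤ ‖w‖ ^ 2 ∧ Real.cos φ ^ 2 * ‖w‖ ^ 2 < inner ℝ w u ^ 2 := by
  have hn : r ≤ ‖w‖ ^ 2 := Real.sqrt_le_left (norm_nonneg w) |>.mp hw.1
  refine ⟨hn, (lineAngle_lt_iff ?_ hu hφ hφ').mp hw.2.2⟩
  rintro rfl
  simp at hn
  linarith

/-- The cone is invariant under scaling, and the inner radius is attained because `r < R`; the outer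
radius therefore adds no constraint. -/
theorem smul_mem_sectorRegion {M : ℕ} {R : ℝ≥0∞} {r φ : ℝ} {u : EuclideanSpace ℝ (Fin M)}
    (hr : 0 < r) (hR : ENNReal.ofReal r < R) (hu : ‖u‖ = 1) (hφ : 0 < φ)
    (hφ' : φ < Real.pi / 2) {w : EuclideanSpace ℝ (Fin M)}
    (hw : Real.cos φ ^ 2 * ‖w‖ ^ 2 < inner ℝ w u ^ 2) :
    (√r / ‖w‖) • w ∈ sectorRegion R r u φ := by
  have hw0 : w ≠ 0 := by rintro rfl; simp at hw
  have hn : 0 < ‖w‖ := norm_pos_iff.mpr hw0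
  have ht : 0 < √r / ‖w‖ := div_pos (Real.sqrt_pos.mpr hr) hn
  have hnorm : ‖(√r / ‖w‖) • w‖ = √r := by
    rw [norm_smul, Real.norm_of_nonneg ht.le, div_mul_cancel₀ _ hn.ne']
  refine ⟨hnorm.ge, ?_, (lineAngle_lt_iff (smul_ne_zero ht.ne' hw0) hu hφ hφ').mpr ?_⟩
  · rwa [← ofReal_norm, hnorm, ← ENNReal.ofReal_pow (Real.sqrt_nonneg r),
      Real.sq_sqrt hr.le]
  · rw [norm_smul, real_inner_smul_left, Real.norm_of_nonneg ht.le]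
    nlinarith [mul_lt_mul_of_pos_left hw (pow_pos ht 2)]

theorem sectorRegion_nonempty {M : ℕ} {R : ℝ≥0∞} {r φ : ℝ} {u : EuclideanSpace ℝ (Fin M)}
    (hr : 0 < r) (hR : ENNReal.ofReal r < R) (hu : ‖u‖ = 1) (hφ : 0 < φ)
    (hφ' : φ < Real.pi / 2) : (sectorRegion R r u φ).Nonempty := by
  refine ⟨_, smul_mem_sectorRegion hr hR hu hφ hφ' (w := u) ?_⟩
  have hcos : 0 < Real.cos φ := Real.cos_pos_of_mem_Ioo ⟨by linarith, hφ'⟩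
  have hcos' : Real.cos φ < 1 := by
    simpa using Real.cos_lt_cos_of_nonneg_of_le_pi_div_two le_rfl hφ'.le hφ
  simp only [real_inner_self_eq_norm_sq, hu]
  nlinarith

/-- A quadratic constraint `wᵀ A w ≥ 1` holds robustly on a sector region if and only if the
corresponding linear matrix inequality has a multiplier. -/
theorem forall_sectorRegion_iff_exists_posSemidef {M : ℕ} {R : ℝ≥0∞} {r φ : ℝ}
    {u : EuclideanSpace ℝ (Fin M)} (hr : 0 < r) (hR : ENNReal.ofReal r < R) (hu : ‖u‖ = 1)
    (hφ : 0 < φ) (hφ' : φ < Real.pi / 2) {A : Matrix (Fin M) (Fin M) ℝ} (hA : A.IsHermitian) :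
    (∀ w ∈ sectorRegion R r u φ, 1 ≤ w.ofLp ⬝ᵥ A.mulVec w) ↔
      ∃ lam mu : ℝ, (A - ((lam - mu) • (1 : Matrix (Fin M) (Fin M) ℝ)
        + (mu / Real.cos φ ^ 2) • Matrix.vecMulVec u u)).PosSemidef ∧ lam ≥ 1 / r ∧ mu ≥ 0 := by
  have hcos : 0 < Real.cos φ := Real.cos_pos_of_mem_Ioo ⟨by linarith, hφ'⟩
  have hcos2 : 0 < Real.cos φ ^ 2 := pow_pos hcos 2
  have hquad (lam mu : ℝ) (w : EuclideanSpace ℝ (Fin M)) :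
      w.ofLp ⬝ᵥ (A - ((lam - mu) • (1 : Matrix (Fin M) (Fin M) ℝ)
        + (mu / Real.cos φ ^ 2) • Matrix.vecMulVec u u)).mulVec w =
      w.ofLp ⬝ᵥ A.mulVec w - lam * ‖w‖ ^ 2
        - mu * (inner ℝ w u ^ 2 / Real.cos φ ^ 2 - ‖w‖ ^ 2) := by
    simp only [Matrix.sub_mulVec, Matrix.add_mulVec, Matrix.smul_mulVec, Matrix.one_mulVec,
      dotProduct_sub, dotProduct_add, dotProduct_smul, smul_eq_mul,
      EuclideanSpace.dotProduct_vecMulVec_mulVec, EuclideanSpace.dotProduct_self]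
    ring
  constructor
  · intro h
    set q : QuadraticForm ℝ (Fin M → ℝ) := Matrix.toQuadraticForm'
      ((1 / Real.cos φ ^ 2) • Matrix.vecMulVec u u - (1 : Matrix (Fin M) (Fin M) ℝ)) with hqdef
    set p : QuadraticForm ℝ (Fin M → ℝ) := Matrix.toQuadraticForm'
      (A - (1 / r) • (1 : Matrix (Fin M) (Fin M) ℝ)) with hpdef
    have happly (B : Matrix (Fin M) (Fin M) ℝ) (x : Fin M → ℝ) :
        B.toQuadraticForm' x = x ⬝ᵥ B.mulVec x := by
      simp [Matrix.toQuadraticForm', Matrix.toLinearMap₂'_apply']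
    have hq (w : EuclideanSpace ℝ (Fin M)) :
        q w.ofLp = inner ℝ w u ^ 2 / Real.cos φ ^ 2 - ‖w‖ ^ 2 := by
      simp only [hqdef, happly, Matrix.sub_mulVec, Matrix.smul_mulVec, Matrix.one_mulVec,
        dotProduct_sub, dotProduct_smul, smul_eq_mul,
        EuclideanSpace.dotProduct_vecMulVec_mulVec, EuclideanSpace.dotProduct_self]
      ring
    have hp (w : EuclideanSpace ℝ (Fin M)) :
        p w.ofLp = w.ofLp ⬝ᵥ A.mulVec w - 1 / r * ‖w‖ ^ 2 := by
      simp only [hpdef, happly, Matrix.sub_mulVec, Matrix.smul_mulVec, Matrix.one_mulVec,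
        dotProduct_sub, dotProduct_smul, smul_eq_mul, EuclideanSpace.dotProduct_self]
    have hq_pos (w : EuclideanSpace ℝ (Fin M)) :
        0 < q w.ofLp ↔ Real.cos φ ^ 2 * ‖w‖ ^ 2 < inner ℝ w u ^ 2 := by
      rw [hq, sub_pos, lt_div_iff₀ hcos2, mul_comm]
    obtain ⟨w₀, hw₀⟩ := sectorRegion_nonempty hr hR hu hφ hφ'
    obtain ⟨mu, hmu, hle⟩ := QuadraticMap.exists_multiplier_of_nonneg_on_pos (p := p) (q := q)
      ((hq_pos w₀).mpr (le_norm_sq_and_lt_inner_sq_of_mem_sectorRegion hr hu hφ hφ' hw₀).2) (by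
        intro x hx
        have hx' := (hq_pos (WithLp.toLp 2 x)).mp hx
        have hmem := h _ (smul_mem_sectorRegion hr hR hu hφ hφ' hx')
        change 0 ≤ p (WithLp.toLp 2 x).ofLp
        generalize WithLp.toLp 2 x = w at *
        have hn : 0 < ‖w‖ := by
          rw [norm_pos_iff]
          rintro rfl
          simp at hx'
        -- Rescaling multiplies the form by `r / ‖w‖²`.
        rw [WithLp.ofLp_smul, Matrix.mulVec_smul, dotProduct_smul, smul_dotProduct, smul_eq_mul,
          smul_eq_mul, ← mul_assoc, ← sq, div_pow, Real.sq_sqrt hr.le, div_mul_eq_mul_div,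
          le_div_iff₀ (pow_pos hn 2), one_mul] at hmem
        rw [hp, sub_nonneg, one_div_mul_eq_div, div_le_iff₀ hr]
        linarith)
    refine ⟨1 / r, mu, Matrix.PosSemidef.of_dotProduct_mulVec_nonneg ?_ fun x => ?_, le_rfl, hmu⟩
    · refine hA.sub (Matrix.IsHermitian.add ?_ ?_)
      · ext i j
        by_cases hij : i = j
        · simp [hij]
        · simp [hij, Ne.symm hij]
      · ext i j
        simp [Matrix.vecMulVec_apply, mul_comm]
    · have := hle x
      rw [← WithLp.ofLp_toLp 2 x, hq, hp] at this
      have hx := hquad (1 / r) mu (WithLp.toLp 2 x)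
      rw [star_trivial]
      simp only at hx this
      rw [hx]
      linarith
  · rintro ⟨lam, mu, hpsd, hlam, hmu⟩ w hw
    obtain ⟨hn, hin⟩ := le_norm_sq_and_lt_inner_sq_of_mem_sectorRegion hr hu hφ hφ' hw
    have hge := hpsd.dotProduct_mulVec_nonneg w.ofLp
    rw [star_trivial, hquad] at hge
    have h1 : 0 ≤ mu * (inner ℝ w u ^ 2 / Real.cos φ ^ 2 - ‖w‖ ^ 2) := by
      refine mul_nonneg hmu (sub_nonneg.mpr ?_)
      rw [le_div_iff₀ hcos2, mul_comm]
      exact hin.le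
    have h2 : 1 ≤ lam * ‖w‖ ^ 2 := by
      calc (1 : ℝ) = 1 / r * r := by field_simp
        _ ≤ lam * ‖w‖ ^ 2 := by gcongr; exact (by positivity : (0 : ℝ) ≤ 1 / r).trans hlam
    linarith

/-! ### Reduction to the active users -/

namespace PowerControlData

variable {M : ℕ} {D : PowerControlData M}

/-- The matrix of the quadratic form `w ↦ P_k |wᵀ v_k|² / γ_k - ∑_{l ≠ k} P_l |wᵀ v_l|²`. -/
noncomputable def margin (D : PowerControlData M) (P : Fin M → ℝ) (k : Fin M) : Matrix (Fin M) (Fin M) ℝ :=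
  (1 / D.γ k * P k) • Matrix.vecMulVec (D.v k) (D.v k)
    - ∑ l ∈ Finset.univ.erase k, P l • Matrix.vecMulVec (D.v l) (D.v l)

theorem isHermitian_margin (P : Fin M → ℝ) (k : Fin M) : (D.margin P k).IsHermitian := by
  ext i j
  simp [margin, Matrix.vecMulVec_apply, Matrix.sum_apply, mul_comm]

theorem dotProduct_margin_mulVec (P : Fin M → ℝ) (k : Fin M) (w : EuclideanSpace ℝ (Fin M)) :
    w.ofLp ⬝ᵥ (D.margin P k).mulVec w = 1 / D.γ k * P k * inner ℝ w (D.v k) ^ 2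
      - ∑ l ∈ Finset.univ.erase k, P l * inner ℝ w (D.v l) ^ 2 := by
  simp only [margin, Matrix.sub_mulVec, Matrix.smul_mulVec, Matrix.sum_mulVec,
    dotProduct_sub, dotProduct_smul, dotProduct_sum, smul_eq_mul,
    EuclideanSpace.dotProduct_vecMulVec_mulVec]

theorem sinr_nonneg {P : Fin M → ℝ} (hP : ∀ k, 0 ≤ P k) (k : Fin M)
    (w : EuclideanSpace ℝ (Fin M)) : 0 ≤ D.sinr P k w := by
  have := hP k
  have : 0 ≤ ∑ l ∈ Finset.univ.erase k, P l * |inner ℝ w (D.v l)| ^ 2 :=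
    Finset.sum_nonneg fun l _ => mul_nonneg (hP l) (by positivity)
  unfold sinr
  positivity

theorem le_sinr_iff {P : Fin M → ℝ} (hP : ∀ k, 0 ≤ P k) {k : Fin M} (hγ : 0 < D.γ k)
    (w : EuclideanSpace ℝ (Fin M)) :
    D.γ k ≤ D.sinr P k w ↔ 1 ≤ w.ofLp ⬝ᵥ (D.margin P k).mulVec w := by
  have hsum : 0 ≤ ∑ l ∈ Finset.univ.erase k, P l * inner ℝ w (D.v l) ^ 2 :=
    Finset.sum_nonneg fun l _ => mul_nonneg (hP l) (by positivity)
  simp only [sinr, sq_abs]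
  rw [le_div_iff₀ (by linarith), dotProduct_margin_mulVec, le_sub_iff_add_le, mul_assoc,
    one_div_mul_eq_div, le_div_iff₀ hγ, mul_comm (D.γ k), add_comm]

/-- Robust feasibility expressed through the quadratic forms of the active users. -/
theorem robustFeasible_iff (hγ : ∀ k ∈ D.K, 0 < D.γ k)
    (hne : ∀ k ∈ D.K, (D.region k).Nonempty) (P : Fin M → ℝ) :
    D.RobustFeasible P ↔ (∀ k, 0 ≤ P k) ∧
      ∀ k ∈ D.K, ∀ w ∈ D.region k, 1 ≤ w.ofLp ⬝ᵥ (D.margin P k).mulVec w := by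
  refine and_congr_right fun hP => forall_congr' fun k => ?_
  have hbdd : BddBelow (Set.range fun w : D.region k => D.sinr P k w) :=
    ⟨0, by rintro _ ⟨w, rfl⟩; exact sinr_nonneg hP k w⟩
  by_cases hk : k ∈ D.K
  · have := (hne k hk).to_subtype
    -- Nonemptiness and the lower bound matter: otherwise the real infimum would take the default
    -- value `0`.
    simp only [flag, hk, if_true, mul_one, ge_iff_le, le_ciInf_iff hbdd, true_imp_iff,
      Subtype.forall, le_sinr_iff hP (hγ k hk)]
  -- The target is `0`, which even the default infimum over an empty region meets.
  · simpa [flag, hk] using Real.iInf_nonneg fun w : D.region k => sinr_nonneg hP k w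

theorem extend_apply (p : D.K → ℝ) (k : D.K) : D.extend p k = p k := by
  simp [extend]

theorem extend_of_notMem (p : D.K → ℝ) {k : Fin M} (hk : k ∉ D.K) : D.extend p k = 0 := by
  simp [extend, hk]

theorem extend_restrict {P : Fin M → ℝ} (hP : ∀ k, k ∉ D.K → P k = 0) :
    D.extend (fun k => P k) = P := by
  funext k
  by_cases hk : k ∈ D.K
  · simp [extend, hk]
  · simp [extend, hk, hP k hk]

theorem extend_restrict_le {P : Fin M → ℝ} (hP : ∀ k, 0 ≤ P k) (k : Fin M) :
    D.extend (fun k => P k) k ≤ P k := by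
  by_cases hk : k ∈ D.K
  · simp [extend, hk]
  · simp [extend, hk, hP k]

theorem extend_nonneg_iff (p : D.K → ℝ) : (∀ k, 0 ≤ D.extend p k) ↔ ∀ k, 0 ≤ p k := by
  refine ⟨fun h k => by simpa [extend_apply] using h k, fun h k => ?_⟩
  by_cases hk : k ∈ D.K
  · simpa [extend, hk] using h ⟨k, hk⟩
  · simp [extend, hk]

theorem robustObjective_extend (p : D.K → ℝ) :
    robustObjective (D.extend p) = D.sdpObjective p := by
  rw [robustObjective, sdpObjective,
    ← Finset.sum_subset (Finset.subset_univ D.K) fun k _ hk => extend_of_notMem p hk,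
    ← Finset.sum_coe_sort]
  exact Finset.sum_congr rfl fun k _ => extend_apply p k

theorem lmi_eq_margin_sub (p lam mu : D.K → ℝ) (k : D.K) :
    D.lmi p lam mu k = D.margin (D.extend p) k
      - ((lam k - mu k) • (1 : Matrix (Fin M) (Fin M) ℝ)
        + (mu k / Real.cos (D.φ k) ^ 2) • Matrix.vecMulVec (D.u k) (D.u k)) := by
  have hsum : ∑ l ∈ Finset.univ.erase k, p l • Matrix.vecMulVec (D.v l) (D.v l) =
      ∑ l ∈ Finset.univ.erase (k : Fin M), D.extend p l • Matrix.vecMulVec (D.v l) (D.v l) := by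
    rw [← Finset.sum_subset (Finset.erase_subset_erase _ (Finset.subset_univ D.K)) ?_]
    · refine Finset.sum_bij (fun l _ => (l : Fin M)) ?_ ?_ ?_ ?_
      · intro l hl
        exact Finset.mem_erase.mpr ⟨fun h => (Finset.ne_of_mem_erase hl) (Subtype.ext h), l.2⟩
      · exact fun _ _ _ _ h => Subtype.ext h
      · intro l hl
        obtain ⟨hlk, hl⟩ := Finset.mem_erase.mp hl
        exact ⟨⟨l, hl⟩, by simpa [Subtype.ext_iff] using hlk, rfl⟩
      · intro l _
        rw [extend_apply]
    · intro l hl hl'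
      have hlK : l ∉ D.K := fun h =>
        hl' (Finset.mem_erase.mpr ⟨Finset.ne_of_mem_erase hl, h⟩)
      rw [extend_of_notMem p hlK, zero_smul]
  rw [lmi, margin, hsum, extend_apply]

/-- An active user keeps its own power while the interference terms can only decrease. -/
theorem RobustFeasible.extend_restrict (hγ : ∀ k ∈ D.K, 0 < D.γ k)
    (hne : ∀ k ∈ D.K, (D.region k).Nonempty) {P : Fin M → ℝ} (h : D.RobustFeasible P) :
    D.RobustFeasible (D.extend fun k => P k) := by
  rw [robustFeasible_iff hγ hne] at h ⊢
  refine ⟨(extend_nonneg_iff _).mpr fun k => h.1 k, fun k hk w hw => (h.2 k hk w hw).trans ?_⟩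
  rw [dotProduct_margin_mulVec, dotProduct_margin_mulVec, extend_apply _ (⟨k, hk⟩ : D.K)]
  gcongr with l
  exact extend_restrict_le h.1 l

theorem robustFeasible_extend_iff (hγ : ∀ k ∈ D.K, 0 < D.γ k) (hr : ∀ k ∈ D.K, 0 < D.r k)
    (hR : ∀ k ∈ D.K, ENNReal.ofReal (D.r k) < D.R k) (hu : ∀ k ∈ D.K, ‖D.u k‖ = 1)
    (hφ : ∀ k ∈ D.K, 0 < D.φ k ∧ D.φ k < Real.pi / 2) (p : D.K → ℝ) :
    D.RobustFeasible (D.extend p) ↔ ∃ lam mu : D.K → ℝ, D.SDPFeasible p lam mu := by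
  have hmult (k : Fin M) (hk : k ∈ D.K) := forall_sectorRegion_iff_exists_posSemidef
    (hr k hk) (hR k hk) (hu k hk) (hφ k hk).1 (hφ k hk).2
    (isHermitian_margin (D := D) (D.extend p) k)
  rw [robustFeasible_iff hγ fun k hk =>
    sectorRegion_nonempty (hr k hk) (hR k hk) (hu k hk) (hφ k hk).1 (hφ k hk).2]
  simp only [SDPFeasible, lmi_eq_margin_sub]
  constructor
  · rintro ⟨hp, h⟩
    choose lam mu hlm using fun k : D.K => (hmult k k.2).mp (h k k.2)
    exact ⟨lam, mu, fun k => ⟨(hlm k).1, (hlm k).2.1, (hlm k).2.2, (extend_nonneg_iff p).mp hp k⟩⟩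
  · rintro ⟨lam, mu, h⟩
    refine ⟨(extend_nonneg_iff p).mpr fun k => (h k).2.2.2, fun k hk => (hmult k hk).mpr ?_⟩
    exact ⟨lam ⟨k, hk⟩, mu ⟨k, hk⟩, (h ⟨k, hk⟩).1, (h ⟨k, hk⟩).2.1, (h ⟨k, hk⟩).2.2.1⟩

theorem robustObjective_extend_restrict_le {P : Fin M → ℝ} (hP : ∀ k, 0 ≤ P k) :
    robustObjective (D.extend fun k => P k) ≤ robustObjective P :=
  Finset.sum_le_sum fun k _ => extend_restrict_le hP k

end PowerControlData

theorem theorem2 {M : ℕ} (hM : 3 ≤ M) (D : PowerControlData M)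
    (hγ : ∀ k ∈ D.K, 0 < D.γ k)
    (hr : ∀ k ∈ D.K, 0 < D.r k)
    (hR : ∀ k ∈ D.K, ENNReal.ofReal (D.r k) < D.R k)
    (hu : ∀ k ∈ D.K, ‖D.u k‖ = 1)
    (hφ : ∀ k ∈ D.K, 0 < D.φ k ∧ D.φ k < Real.pi / 2) :
    (∀ p : D.K → ℝ,
      PowerControlData.robustObjective (D.extend p) = D.sdpObjective p ∧
      (D.RobustFeasible (D.extend p) ↔ ∃ lam mu : D.K → ℝ, D.SDPFeasible p lam mu)) ∧
    (∀ P : Fin M → ℝ, D.RobustFeasible P →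
      ∃ lam mu : D.K → ℝ, D.SDPFeasible (fun k => P k) lam mu) ∧
    D.robustValue = D.sdpValue ∧
    (∀ P : Fin M → ℝ, D.RobustOptimal P ↔
      (∀ k, k ∉ D.K → P k = 0) ∧
        ∃ lam mu : D.K → ℝ, D.SDPOptimal (fun k => P k) lam mu) := by
  have hne : ∀ k ∈ D.K, (D.region k).Nonempty := fun k hk =>
    sectorRegion_nonempty (hr k hk) (hR k hk) (hu k hk) (hφ k hk).1 (hφ k hk).2
  have hobj (p : D.K → ℝ) := PowerControlData.robustObjective_extend p
  have hext (p : D.K → ℝ) := PowerControlData.robustFeasible_extend_iff hγ hr hR hu hφ p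
  have hres (P : Fin M → ℝ) (hP : D.RobustFeasible P) := hP.extend_restrict hγ hne
  have hle (P : Fin M → ℝ) (hP : D.RobustFeasible P) :
      D.sdpObjective (fun k => P k) ≤ PowerControlData.robustObjective P :=
    (hobj _).ge.trans (PowerControlData.robustObjective_extend_restrict_le hP.1)
  refine ⟨fun p => ⟨hobj p, hext p⟩, fun P hP => (hext _).mp (hres P hP), ?_, fun P => ?_⟩
  · refine le_antisymm ?_ ?_
    · refine le_iInf fun p => le_iInf fun lam => le_iInf fun mu => le_iInf fun h => ?_
      exact (iInf₂_le (D.extend p) ((hext p).mpr ⟨lam, mu, h⟩)).trans_eq (by rw [hobj])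
    · refine le_iInf₂ fun P hP => ?_
      obtain ⟨lam, mu, h⟩ := (hext _).mp (hres P hP)
      exact iInf_le_of_le _ <| iInf_le_of_le lam <| iInf_le_of_le mu <| iInf_le_of_le h <|
        EReal.coe_le_coe_iff.mpr (hle P hP)
  · constructor
    · rintro ⟨hP, hopt⟩
      -- Truncation is feasible and lowers no total by optimality, so the termwise inequalities are
      -- equalities.
      have hzero : ∀ k, k ∉ D.K → P k = 0 := by
        have hsum : ∑ k, D.extend (fun k => P k) k = ∑ k, P k :=
          le_antisymm (PowerControlData.robustObjective_extend_restrict_le hP.1)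
            (hopt _ (hres P hP))
        have heq := (Finset.sum_eq_sum_iff_of_le fun k _ =>
          PowerControlData.extend_restrict_le (D := D) hP.1 k).mp hsum
        intro k hk
        rw [← heq k (Finset.mem_univ k), PowerControlData.extend_of_notMem _ hk]
      obtain ⟨lam, mu, h⟩ := (hext _).mp (hres P hP)
      refine ⟨hzero, lam, mu, h, fun p' lam' mu' h' => (hle P hP).trans ?_⟩
      exact (hopt _ ((hext p').mpr ⟨lam', mu', h'⟩)).trans_eq (hobj p')
    · rintro ⟨hzero, lam, mu, h, hopt⟩
      have hPeq := PowerControlData.extend_restrict hzero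
      refine ⟨hPeq ▸ (hext _).mpr ⟨lam, mu, h⟩, fun P' hP' => ?_⟩
      obtain ⟨lam', mu', h'⟩ := (hext _).mp (hres P' hP')
      rw [← hPeq, hobj]
      exact (hopt _ _ _ h').trans (hle P' hP')
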